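/- All spaces are Tychonoff. A set $C$ in a space $X$ is regularly closed if $C=\overline{\mathrm{Int}\,C}$. A quasi $\kappa$-metric on $X$ is a function $\rho$ assigning to each point $x\in X$ and each regularly closed set $C\subset X$ a real number $\rho(x,C)\ge 0$ such that (1) for every regularly closed $C$ there is a dense open subset $V$ of $X\setminus C$ such that, for all $x\in X$, $\rho(x,C)>0$ if and only if $x\in V$; (2) if $C\subset C'$ are regularly closed, then $\rho(x,C')\le\rho(x,C)$ for every $x\in X$; (3) for every regularly closed $C$ the function $x\mapsto\rho(x,C)$ is continuous on $X$; (4) $\rho\bigl(x,\overline{\bigcup_\alpha C_\alpha}\bigr)=\inf_\alpha\rho(x,C_\alpha)$ for every $x\in X$ and every non-empty increasing transfinite (that is, well-ordered) family $\{C_\alpha\}$ of regularly closed sets in $X$. It is regular if, moreover, (5) $\rho(x,C)\le\rho(x,C')+\sup\{\rho(y,C):y\in C'\}$ for every $x\in X$ and all regularly closed $C,C'\subset X$, where the supremum is taken in $[0,\infty]$ (so it is $0$ if $C'=\varnothing$). A space is (regularly) quasi $\kappa$-metrizable if it admits a (regular) quasi $\kappa$-metric. **Theorem.** Let $(X_i)_{i\in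 I}$ be an arbitrary family of Tychonoff spaces. If every $X_i$ is quasi $\kappa$-metrizable, then the product $\prod_{i\in I}X_i$ is quasi $\kappa$-metrizable. If every $X_i$ is regularly quasi $\kappa$-metrizable, then $\prod_{i\in I}X_i$ is regularly quasi $\kappa$-metrizable. -/

import Mathlib

open scoped NNReal ENNReal

universe u v

/-- A set is regularly closed if it is the closure of its interior. -/
def IsRegularlyClosed {X : Type u} [TopologicalSpace X] (C : Set X) : Prop :=
  closure (interior C) = C

/-- `ρ` is a quasi κ-metric on `X`: a non-negative real function `ρ x C` of a point `x` and a
regularly closed set `C` (the values of `ρ x` at other sets are irrelevant). -/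
structure IsQuasiKappaMetric {X : Type u} [TopologicalSpace X] (ρ : X → Set X → ℝ≥0) :
    Prop where
  /-- For each `C`, the set where `ρ · C` is positive is a dense open subset of `X \ C`. -/
  exists_dense_open : ∀ C : Set X, IsRegularlyClosed C →
    ∃ V : Set X, IsOpen V ∧ V ⊆ Cᶜ ∧ Cᶜ ⊆ closure V ∧ ∀ x : X, 0 < ρ x C ↔ x ∈ V
  /-- `ρ` is decreasing in the set variable. -/
  anti : ∀ C C' : Set X, IsRegularlyClosed C → IsRegularlyClosed C' → C ⊆ C' →
    ∀ x : X, ρ x C' ≤ ρ x C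
  /-- `ρ` is continuous in the point variable. -/
  continuous_left : ∀ C : Set X, IsRegularlyClosed C → Continuous fun x : X => ρ x C
  /-- Compatibility with increasing transfinite (i.e. well-ordered, non-empty) families. An index
  in the universe of `X` is no restriction, since the range of such a family is well-ordered. -/
  closure_iUnion : ∀ (κ : Type u) [LinearOrder κ] [WellFoundedLT κ] [Nonempty κ]
    (C : κ → Set X), (∀ a, IsRegularlyClosed (C a)) → Monotone C →
    ∀ x : X, ρ x (closure (⋃ a, C a)) = ⨅ a, ρ x (C a)

/-- `ρ` is a regular quasi κ-metric: moreover `ρ(x, C) ≤ ρ(x, C') + sup {ρ(y, C) : y ∈ C'}`.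
The supremum is taken in `[0, ∞]`, so that it is `∞` when unbounded and `0` when `C'` is empty. -/
structure IsRegularQuasiKappaMetric {X : Type u} [TopologicalSpace X] (ρ : X → Set X → ℝ≥0) :
    Prop extends IsQuasiKappaMetric ρ where
  le_add_iSup : ∀ C C' : Set X, IsRegularlyClosed C → IsRegularlyClosed C' → ∀ x : X,
    (ρ x C : ℝ≥0∞) ≤ (ρ x C' : ℝ≥0∞) + ⨆ y ∈ C', (ρ y C : ℝ≥0∞)

/-- A space is quasi κ-metrizable if it admits a quasi κ-metric. -/
def QuasiKappaMetrizable (X : Type u) [TopologicalSpace X] : Prop :=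
  ∃ ρ : X → Set X → ℝ≥0, IsQuasiKappaMetric ρ

/-- A space is regularly quasi κ-metrizable if it admits a regular quasi κ-metric. -/
def RegularlyQuasiKappaMetrizable (X : Type u) [TopologicalSpace X] : Prop :=
  ∃ ρ : X → Set X → ℝ≥0, IsRegularQuasiKappaMetric ρ

/-!
If `ρ i` is a quasi κ-metric on each factor, measure the distance from `x` to `C` in the product by
the largest `v` for which finitely many cylinders over regularly closed sets `D i`, `i ∈ K`, cover
`C` with `v ≤ ρ i (x i) (D i)` and `v ≤ 1 / (|K| + 1)`. The second bound keeps the supports `K`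
small, so that a family of such covers has a limit along any ultrafilter: its support consists of
the indices that are eventually used, and in each coordinate it is a regularly closed lower limit.
Both upper semicontinuity in the point and compatibility with increasing families are instances of
this one limit argument. In a factor it needs `ρ i` to be compatible with directed unions, which
follows from compatibility with well-ordered ones by transfinite induction.
-/

open Filter Set Topology

section RegularlyClosed

variable {X : Type u} [TopologicalSpace X] {A B C G S U : Set X} {α : Type*} {l : Filter α}
  {F : α → Set X}

theorem isRegularlyClosed_closure_of_isOpen (hU : IsOpen U) : IsRegularlyClosed (closure U) := by
  rw [← hU.interior_eq]
  exact closure_interior_idem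

theorem isRegularlyClosed_compl_interior_closure (S : Set X) :
    IsRegularlyClosed (interior (closure S))ᶜ := by
  rw [← closure_compl]
  exact isRegularlyClosed_closure_of_isOpen isClosed_closure.isOpen_compl

namespace IsRegularlyClosed

theorem closure_interior_eq (hC : IsRegularlyClosed C) : closure (interior C) = C := hC

theorem isClosed (hC : IsRegularlyClosed C) : IsClosed C := by
  rw [← hC.closure_interior_eq]
  exact isClosed_closure

theorem subset_closure_interior (hC : IsRegularlyClosed C) (hCS : C ⊆ S) :
    C ⊆ closure (interior S) :=
  hC.closure_interior_eq.symm.subset.trans (closure_mono (interior_mono hCS))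

theorem of_isClosed (hS : IsClosed S) (h : S ⊆ closure (interior S)) : IsRegularlyClosed S :=
  hS.closure_interior_subset.antisymm h

theorem closure_iUnion {κ : Type*} {E : κ → Set X} (hE : ∀ a, IsRegularlyClosed (E a)) :
    IsRegularlyClosed (closure (⋃ a, E a)) :=
  of_isClosed isClosed_closure <| closure_minimal
    (iUnion_subset fun a => (hE a).subset_closure_interior
      ((subset_iUnion E a).trans subset_closure)) isClosed_closure

theorem biUnion_finset {κ : Type*} {E : κ → Set X} {t : Finset κ}
    (hE : ∀ a ∈ t, IsRegularlyClosed (E a)) : IsRegularlyClosed (⋃ a ∈ t, E a) :=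
  of_isClosed (isClosed_biUnion_finset fun a ha => (hE a ha).isClosed) <|
    iUnion₂_subset fun a ha => (hE a ha).subset_closure_interior
      (subset_biUnion_of_mem (u := E) (s := (t : Set κ)) ha)

theorem union (hA : IsRegularlyClosed A) (hB : IsRegularlyClosed B) : IsRegularlyClosed (A ∪ B) :=
  of_isClosed (hA.isClosed.union hB.isClosed) <| union_subset
    (hA.subset_closure_interior subset_union_left) (hB.subset_closure_interior subset_union_right)

theorem disjoint_interior_closure (hC : IsRegularlyClosed C) (h : Disjoint C G) :
    Disjoint C (interior (closure G)) := by
  rw [← hC.closure_interior_eq]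
  refine Disjoint.closure_left (Disjoint.mono_right interior_subset ?_) isOpen_interior
  exact (h.mono_left interior_subset).closure_right isOpen_interior

end IsRegularlyClosed

theorem subset_closure_iUnion_Iic {κ : Type*} [Preorder κ] (E : κ → Set X) {i j : κ}
    (hji : j ≤ i) : E j ⊆ closure (⋃ k : Iic i, E k) :=
  (subset_iUnion (fun k : Iic i => E k) ⟨j, hji⟩).trans subset_closure

theorem closure_iUnion_Iic_subset {κ : Type*} [PartialOrder κ] {E : κ → Set X} {i : κ}
    (hE : IsClosed (E i)) : closure (⋃ j : Iic i, E j) ⊆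
      closure (⋃ j : Iio i, closure (⋃ k : Iic j.1, E k)) ∪ E i := by
  refine closure_minimal (iUnion_subset ?_) (isClosed_closure.union hE)
  rintro ⟨j, hj⟩
  obtain hji | rfl := (mem_Iic.1 hj).lt_or_eq
  · exact subset_union_of_subset_left ((subset_closure_iUnion_Iic E le_rfl).trans
      ((subset_iUnion (fun j : Iio i => closure (⋃ k : Iic j.1, E k)) ⟨j, hji⟩).trans
        subset_closure)) _
  · exact subset_union_right

/-- The regularly closed lower limit of a family of sets along a filter: the closure of the union
of the open sets that are eventually contained in the members of the family. -/
def regularLiminf (l : Filter α) (F : α → Set X) : Set X :=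
  closure (⋃ U : {U : Set X // IsOpen U ∧ ∀ᶠ a in l, U ⊆ F a}, U.1)

theorem isRegularlyClosed_regularLiminf (l : Filter α) (F : α → Set X) :
    IsRegularlyClosed (regularLiminf l F) :=
  isRegularlyClosed_closure_of_isOpen (isOpen_iUnion fun U => U.2.1)

theorem subset_regularLiminf_of_isOpen (hU : IsOpen U) (h : ∀ᶠ a in l, U ⊆ F a) :
    U ⊆ regularLiminf l F :=
  (subset_iUnion (fun U : {U : Set X // IsOpen U ∧ ∀ᶠ a in l, U ⊆ F a} => U.1)
    ⟨U, hU, h⟩).trans subset_closure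

theorem IsRegularlyClosed.subset_regularLiminf (hC : IsRegularlyClosed C)
    (h : ∀ᶠ a in l, C ⊆ F a) : C ⊆ regularLiminf l F := by
  rw [← hC.closure_interior_eq]
  exact closure_minimal (subset_regularLiminf_of_isOpen isOpen_interior
    (h.mono fun _ => interior_subset.trans)) isClosed_closure

theorem regularLiminf_subset (hB : IsClosed B)
    (h : ∀ U, IsOpen U → (∀ᶠ a in l, U ⊆ F a) → U ⊆ B) : regularLiminf l F ⊆ B :=
  closure_minimal (iUnion_subset fun U => h U.1 U.2.1 U.2.2) hB

end RegularlyClosed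

namespace IsQuasiKappaMetric

variable {X : Type u} [TopologicalSpace X] {ρ : X → Set X → ℝ≥0} {x : X} {C G : Set X} {ε : ℝ≥0}

theorem notMem_of_pos (h : IsQuasiKappaMetric ρ) (hC : IsRegularlyClosed C) (hx : 0 < ρ x C) :
    x ∉ C := by
  obtain ⟨V, -, hVC, -, hV⟩ := h.exists_dense_open C hC
  exact hVC ((hV x).1 hx)

theorem exists_pos (h : IsQuasiKappaMetric ρ) (hC : IsRegularlyClosed C) (hG : IsOpen G)
    (hne : G.Nonempty) (hGC : G ⊆ Cᶜ) : ∃ x ∈ G, 0 < ρ x C := by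
  obtain ⟨V, -, -, hVd, hV⟩ := h.exists_dense_open C hC
  obtain ⟨x, hx⟩ := hne
  obtain ⟨y, hyG, hyV⟩ := mem_closure_iff.1 (hVd (hGC hx)) G hG hx
  exact ⟨y, hyG, (hV y).2 hyV⟩

theorem isOpen_setOf_lt (h : IsQuasiKappaMetric ρ) (hC : IsRegularlyClosed C) (r : ℝ≥0) :
    IsOpen {z | ρ z C < r} :=
  isOpen_lt (h.continuous_left C hC) continuous_const

theorem le_closure_iUnion_union (h : IsQuasiKappaMetric ρ) {κ : Type u} [LinearOrder κ]
    [WellFoundedLT κ] {A : κ → Set X} {B : Set X} (hA : ∀ i, IsRegularlyClosed (A i))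
    (hB : IsRegularlyClosed B) (hmono : Monotone A) (hεB : ε ≤ ρ x B)
    (hε : ∀ i, ε ≤ ρ x (A i ∪ B)) : ε ≤ ρ x (closure (⋃ i, A i) ∪ B) := by
  cases isEmpty_or_nonempty κ
  · simpa only [iUnion_of_empty, closure_empty, empty_union] using hεB
  · have hunion : closure (⋃ i, A i) ∪ B = closure (⋃ i, (A i ∪ B)) := by
      rw [← iUnion_union, closure_union, hB.isClosed.closure_eq]
    rw [hunion, h.closure_iUnion κ _ (fun i => (hA i).union hB)
      fun i j hij => union_subset_union_left B (hmono hij)]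
    exact le_ciInf hε

theorem le_closure_iUnion (h : IsQuasiKappaMetric ρ) {κ : Type u} {E : κ → Set X}
    (hE : ∀ i, IsRegularlyClosed (E i)) (hε : ∀ t : Finset κ, ε ≤ ρ x (⋃ i ∈ t, E i)) :
    ε ≤ ρ x (closure (⋃ i, E i)) := by
  classical
  obtain ⟨_, _⟩ := exists_wellFoundedLT κ
  let A : κ → Set X := fun i => closure (⋃ j : Iic i, E j)
  have hA : ∀ i, IsRegularlyClosed (A i) := fun i => .closure_iUnion fun j => hE j
  have hmono : Monotone A := fun i j hij =>
    closure_mono (iUnion_subset fun k =>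
      subset_iUnion_of_subset (⟨k, k.2.trans hij⟩ : Iic j) subset_rfl)
  have hAE : ∀ i, A i ⊆ closure (⋃ j : Iio i, A j) ∪ E i := fun i =>
    closure_iUnion_Iic_subset (hE i).isClosed
  have hEt : ∀ t : Finset κ, IsRegularlyClosed (⋃ j ∈ t, E j) := fun t =>
    .biUnion_finset fun j _ => hE j
  -- Carrying a finite union along reduces `Iic i` with `t` to `Iio i` with `insert i t`.
  have key : ∀ i (t : Finset κ), ε ≤ ρ x (A i ∪ ⋃ j ∈ t, E j) := by
    intro i
    induction i using WellFoundedLT.induction with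
    | ind i ih =>
      intro t
      have hsub : A i ∪ ⋃ j ∈ t, E j ⊆
          closure (⋃ j : Iio i, A j) ∪ ⋃ j ∈ insert i t, E j := by
        rw [Finset.set_biUnion_insert, ← union_assoc]
        exact union_subset_union_left _ (hAE i)
      calc ε ≤ ρ x (closure (⋃ j : Iio i, A j) ∪ ⋃ j ∈ insert i t, E j) :=
            h.le_closure_iUnion_union (fun j => hA j) (hEt _) (fun j k hjk => hmono hjk) (hε _)
              fun j => ih j j.2 _
        _ ≤ ρ x (A i ∪ ⋃ j ∈ t, E j) :=
            h.anti _ _ ((hA i).union (hEt t))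
              ((IsRegularlyClosed.closure_iUnion fun j : Iio i => hA j).union (hEt _)) hsub x
  calc ε ≤ ρ x (closure (⋃ i, A i) ∪ ⋃ j ∈ (∅ : Finset κ), E j) :=
        h.le_closure_iUnion_union hA (hEt ∅) hmono (hε ∅) fun i => key i ∅
    _ ≤ ρ x (closure (⋃ i, E i)) :=
        h.anti _ _ (.closure_iUnion hE) ((IsRegularlyClosed.closure_iUnion hA).union (hEt ∅))
          (subset_union_of_subset_left
            (closure_mono (iUnion_mono fun i => subset_closure_iUnion_Iic E le_rfl)) _) x

theorem le_regularLiminf (h : IsQuasiKappaMetric ρ) {α : Type*} {l : Filter α} [l.NeBot]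
    {ξ : α → X} {D : α → Set X} (hξ : Tendsto ξ l (𝓝 x)) (hD : ∀ᶠ a in l, IsRegularlyClosed (D a))
    (hε : ∀ᶠ a in l, ε ≤ ρ (ξ a) (D a)) : ε ≤ ρ x (regularLiminf l D) := by
  let E : {U : Set X // IsOpen U ∧ ∀ᶠ a in l, U ⊆ D a} → Set X := fun U => closure U.1
  have hE : ∀ U, IsRegularlyClosed (E U) := fun U => isRegularlyClosed_closure_of_isOpen U.2.1
  have hfin : ∀ t : Finset {U : Set X // IsOpen U ∧ ∀ᶠ a in l, U ⊆ D a},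
      ε ≤ ρ x (⋃ U ∈ t, E U) := by
    intro t
    have ht : IsRegularlyClosed (⋃ U ∈ t, E U) := .biUnion_finset fun U _ => hE U
    refine ge_of_tendsto (((h.continuous_left _ ht).tendsto x).comp hξ) ?_
    filter_upwards [hD, hε, (eventually_all_finset t).2 fun U _ => U.2.2] with a hDa hεa hta
    exact hεa.trans <| h.anti _ _ ht hDa
      (iUnion₂_subset fun U hU => closure_minimal (hta U hU) hDa.isClosed) _
  calc ε ≤ ρ x (closure (⋃ U, E U)) := h.le_closure_iUnion hE hfin
    _ ≤ ρ x (regularLiminf l D) :=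
      h.anti _ _ (isRegularlyClosed_regularLiminf l D) (.closure_iUnion hE)
        (closure_mono (iUnion_mono fun _ => subset_closure)) x

end IsQuasiKappaMetric

namespace IsRegularQuasiKappaMetric

variable {X : Type u} [TopologicalSpace X] {ρ : X → Set X → ℝ≥0} {C : Set X}

theorem le_add_closure_setOf_lt (h : IsRegularQuasiKappaMetric ρ) (hC : IsRegularlyClosed C)
    (x : X) (r : ℝ≥0) : ρ x C ≤ ρ x (closure {z | ρ z C < r}) + r := by
  have hreg := isRegularlyClosed_closure_of_isOpen (h.isOpen_setOf_lt hC r)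
  have hle : ∀ z ∈ closure {z | ρ z C < r}, ρ z C ≤ r := fun z hz =>
    closure_lt_subset_le (h.continuous_left C hC) continuous_const hz
  have hsup : ⨆ z ∈ closure {z | ρ z C < r}, (ρ z C : ℝ≥0∞) ≤ r :=
    iSup₂_le fun z hz => ENNReal.coe_le_coe.2 (hle z hz)
  exact_mod_cast (h.le_add_iSup C _ hC hreg x).trans (add_le_add_right hsup _)

end IsRegularQuasiKappaMetric

theorem finite_setOf_eventually_mem {α ι : Type*} {l : Filter α} {K : α → Finset ι} {n : ℕ}
    (h : ∃ᶠ a in l, (K a).card ≤ n) : {i | ∀ᶠ a in l, i ∈ K a}.Finite := by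
  by_contra hinf
  obtain ⟨t, ht, htn⟩ := Set.Infinite.exists_subset_card_eq hinf (n + 1)
  obtain ⟨a, han, hta⟩ := (h.and_eventually ((eventually_all_finset t).2 fun i hi => ht hi)).exists
  have := Finset.card_le_card hta
  omega

theorem exists_subset_of_pi_subset_biUnion {ι : Type*} {X : ι → Type*} {M K : Set ι}
    {O D : ∀ i, Set (X i)} (hO : (M.pi O).Nonempty) (hD : ∀ i ∈ K, D i ≠ univ)
    (h : M.pi O ⊆ ⋃ i ∈ K, Function.eval i ⁻¹' D i) : ∃ i ∈ M, i ∈ K ∧ O i ⊆ D i := by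
  classical
  by_contra! hcon
  obtain ⟨p, hp⟩ := hO
  have hz : ∀ i, ∃ z : X i, (i ∈ M → z ∈ O i) ∧ (i ∈ K → z ∉ D i) := by
    intro i
    by_cases hiK : i ∈ K
    · by_cases hiM : i ∈ M
      · obtain ⟨z, hzO, hzD⟩ := not_subset.1 (hcon i hiM hiK)
        exact ⟨z, fun _ => hzO, fun _ => hzD⟩
      · obtain ⟨z, hz⟩ := (ne_univ_iff_exists_notMem _).1 (hD i hiK)
        exact ⟨z, fun hi => absurd hi hiM, fun _ => hz⟩
    · exact ⟨p i, hp i, fun hi => absurd hi hiK⟩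
  choose z hzO hzD using hz
  obtain ⟨i, hiK, hzi⟩ := mem_iUnion₂.1 (h fun i => hzO i)
  exact hzD i hiK hzi

section Product

variable {ι : Type v} {X : ι → Type u} [∀ i, TopologicalSpace (X i)]

/-- `C` is covered by the cylinders over the regularly closed sets `D i` with `i` in the finite set
`K`; equivalently, `C` misses the basic open box with sides `(D i)ᶜ` for `i ∈ K`. The values of `D`
outside `K` are irrelevant. -/
structure IsCylinderCover (K : Finset ι) (D : ∀ i, Set (X i)) (C : Set (∀ i, X i)) : Prop where
  isRegularlyClosed : ∀ i ∈ K, IsRegularlyClosed (D i)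
  subset : C ⊆ ⋃ i ∈ K, Function.eval i ⁻¹' D i

/-- `v` is at most the radius about `x` of some cylinder cover of `C`, the radius of `(K, D)` being
the least of the numbers `ρ i (x i) (D i)`, for `i ∈ K`, and `1 / (|K| + 1)`. -/
def IsCoverRadius (ρ : ∀ i, X i → Set (X i) → ℝ≥0) (x : ∀ i, X i) (C : Set (∀ i, X i))
    (v : ℝ≥0) : Prop :=
  ∃ (K : Finset ι) (D : ∀ i, Set (X i)), IsCylinderCover K D C ∧
    v ≤ ((K.card : ℝ≥0) + 1)⁻¹ ∧ ∀ i ∈ K, v ≤ ρ i (x i) (D i)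

/-- The product quasi κ-metric: the supremum of the radii about `x` of the cylinder covers of `C`.
It is `0` if there are none, which happens only if `C` is nonempty and `ι` is empty. -/
noncomputable def piKappa (ρ : ∀ i, X i → Set (X i) → ℝ≥0) (x : ∀ i, X i)
    (C : Set (∀ i, X i)) : ℝ≥0 :=
  sSup {v | IsCoverRadius ρ x C v}

variable {ρ : ∀ i, X i → Set (X i) → ℝ≥0} {x : ∀ i, X i} {C C' G : Set (∀ i, X i)} {r v : ℝ≥0}
  {K : Finset ι} {D : ∀ i, Set (X i)} {α : Type*} {𝒰 : Ultrafilter α}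

theorem IsCylinderCover.mono (h : IsCylinderCover K D C') (hC : C ⊆ C') :
    IsCylinderCover K D C :=
  ⟨h.isRegularlyClosed, hC.trans h.subset⟩

theorem IsCylinderCover.regularLiminf {K : α → Finset ι} {D : α → ∀ i, Set (X i)}
    {F : α → Set (∀ i, X i)} {S : Finset ι} (hS : ∀ i, (∀ᶠ a in 𝒰, i ∈ K a) → i ∈ S)
    (hsub : ∀ᶠ a in 𝒰, F a ⊆ ⋃ i ∈ K a, Function.eval i ⁻¹' D a i)
    (hne : ∀ᶠ a in 𝒰, ∀ i ∈ K a, D a i ≠ univ) :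
    IsCylinderCover S (fun i => regularLiminf 𝒰 fun a => D a i) (regularLiminf 𝒰 F) where
  isRegularlyClosed _ _ := isRegularlyClosed_regularLiminf _ _
  subset := by
    refine regularLiminf_subset (isClosed_biUnion_finset fun i _ =>
      isClosed_closure.preimage (continuous_apply i)) fun P hP hPF p hp => ?_
    obtain ⟨M, O, hO, hMP⟩ := isOpen_pi_iff.1 hP p hp
    have hfactor : ∀ᶠ a in 𝒰, ∃ i ∈ (M : Set ι), i ∈ K a ∧ O i ⊆ D a i := by
      filter_upwards [hsub, hne, hPF] with a hsub_a hne_a hPF_a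
      exact exists_subset_of_pi_subset_biUnion ⟨p, fun i hi => (hO i hi).2⟩ hne_a
        (hMP.trans (hPF_a.trans hsub_a))
    obtain ⟨i, hiM, hi⟩ := (Ultrafilter.eventually_exists_mem_iff M.finite_toSet).1 hfactor
    exact mem_iUnion₂.2 ⟨i, hS i (hi.mono fun _ h => h.1),
      subset_regularLiminf_of_isOpen (hO i hiM).1 (hi.mono fun _ h => h.2) (hO i hiM).2⟩

theorem IsCoverRadius.regularLiminf (hρ : ∀ i, IsQuasiKappaMetric (ρ i)) {ξ : α → ∀ i, X i}
    (hξ : Tendsto ξ 𝒰 (𝓝 x)) {F : α → Set (∀ i, X i)} (hv : 0 < v)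
    (h : ∀ᶠ a in 𝒰, IsCoverRadius ρ (ξ a) (F a) v) :
    IsCoverRadius ρ x (regularLiminf 𝒰 F) v := by
  obtain ⟨K, hK⟩ := h.choice
  obtain ⟨D, hD⟩ := hK.choice
  have hbounded : ∀ᶠ a in 𝒰, (K a).card ≤ ⌊v⁻¹⌋₊ := hD.mono fun a ha =>
    Nat.le_floor (le_self_add.trans ((le_inv_comm₀ hv (by positivity)).1 ha.2.1))
  have hfin : {i | ∀ᶠ a in 𝒰, i ∈ K a}.Finite := finite_setOf_eventually_mem hbounded.frequently
  have hmem : ∀ i ∈ hfin.toFinset, ∀ᶠ a in 𝒰, i ∈ K a := fun i hi => hfin.mem_toFinset.1 hi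
  have hne : ∀ᶠ a in 𝒰, ∀ i ∈ K a, D a i ≠ univ := by
    filter_upwards [hD] with a ⟨hcover, _, hle⟩ i hi huniv
    exact (hρ i).notMem_of_pos (hcover.isRegularlyClosed i hi) (hv.trans_le (hle i hi))
      (huniv ▸ mem_univ (ξ a i))
  refine ⟨hfin.toFinset, _, .regularLiminf (fun i => hfin.mem_toFinset.2)
    (hD.mono fun a ha => ha.1.subset) hne, ?_, fun i hi => ?_⟩
  · obtain ⟨a, hsub, -, hcard, -⟩ := (((eventually_all_finset _).2 hmem).and hD).exists
    have : hfin.toFinset.card ≤ (K a).card := Finset.card_le_card hsub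
    exact hcard.trans (by gcongr)
  · have hDi := hD.and (hmem i hi)
    exact (hρ i).le_regularLiminf (((continuous_apply i).tendsto x).comp hξ)
      (hDi.mono fun a ⟨ha, hia⟩ => ha.1.isRegularlyClosed i hia)
      (hDi.mono fun a ⟨ha, hia⟩ => ha.2.2 i hia)

theorem bddAbove_isCoverRadius : BddAbove {v | IsCoverRadius ρ x C v} := by
  refine ⟨1, ?_⟩
  rintro v ⟨K, D, -, hK, -⟩
  exact hK.trans (inv_le_one_of_one_le₀ le_add_self)

theorem IsCoverRadius.le_piKappa (h : IsCoverRadius ρ x C v) : v ≤ piKappa ρ x C :=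
  le_csSup bddAbove_isCoverRadius h

theorem IsCoverRadius.of_lt_piKappa (h : v < piKappa ρ x C) : IsCoverRadius ρ x C v := by
  obtain ⟨w, ⟨K, D, hcover, hK, hD⟩, hvw⟩ := exists_lt_of_lt_csSup' h
  exact ⟨K, D, hcover, hvw.le.trans hK, fun i hi => hvw.le.trans (hD i hi)⟩

theorem piKappa_anti (hC : C ⊆ C') : piKappa ρ x C' ≤ piKappa ρ x C := by
  refine csSup_le_csSup' bddAbove_isCoverRadius ?_
  rintro v ⟨K, D, hcover, hv⟩
  exact ⟨K, D, hcover.mono hC, hv⟩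

theorem le_piKappa_regularLiminf (hρ : ∀ i, IsQuasiKappaMetric (ρ i)) {ξ : α → ∀ i, X i}
    (hξ : Tendsto ξ 𝒰 (𝓝 x)) {F : α → Set (∀ i, X i)}
    (h : ∀ᶠ a in 𝒰, v ≤ piKappa ρ (ξ a) (F a)) : v ≤ piKappa ρ x (regularLiminf 𝒰 F) := by
  refine le_of_forall_lt fun u huv => ?_
  obtain ⟨w, huw, hwv⟩ := exists_between huv
  exact huw.trans_le (IsCoverRadius.regularLiminf hρ hξ (zero_le.trans_lt huw)
    (h.mono fun a ha => .of_lt_piKappa (hwv.trans_le ha))).le_piKappa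

theorem lowerSemicontinuous_piKappa (hρ : ∀ i, IsQuasiKappaMetric (ρ i))
    (C : Set (∀ i, X i)) : LowerSemicontinuous fun x => piKappa ρ x C := by
  intro x b hb
  obtain ⟨u, hbu, hu⟩ := exists_between hb
  obtain ⟨v, huv, hv⟩ := exists_between hu
  obtain ⟨K, D, hcover, hK, hD⟩ := IsCoverRadius.of_lt_piKappa hv
  have hev : ∀ i ∈ K, ∀ᶠ y in 𝓝 x, u < ρ i (y i) (D i) := fun i hi =>
    (((hρ i).continuous_left _ (hcover.isRegularlyClosed i hi)).comp
      (continuous_apply i)).continuousAt.eventually (lt_mem_nhds (huv.trans_le (hD i hi)))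
  filter_upwards [(eventually_all_finset K).2 hev] with y hy
  exact hbu.trans_le (IsCoverRadius.le_piKappa
    ⟨K, D, hcover, huv.le.trans hK, fun i hi => (hy i hi).le⟩)

theorem upperSemicontinuous_piKappa (hρ : ∀ i, IsQuasiKappaMetric (ρ i))
    (hC : IsRegularlyClosed C) : UpperSemicontinuous fun x => piKappa ρ x C := by
  refine fun x b hb => mem_iff_ultrafilter.2 fun 𝒰 h𝒰 => ?_
  by_contra hnot
  have hge : ∀ᶠ y in 𝒰, b ≤ piKappa ρ y C :=
    (Ultrafilter.eventually_not.2 hnot).mono fun _ => not_lt.1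
  have hle : b ≤ piKappa ρ x C :=
    (le_piKappa_regularLiminf hρ (tendsto_id.mono_left h𝒰) hge).trans
      (piKappa_anti (hC.subset_regularLiminf (.of_forall fun _ => subset_rfl)))
  exact hb.not_ge hle

theorem continuous_piKappa (hρ : ∀ i, IsQuasiKappaMetric (ρ i)) (hC : IsRegularlyClosed C) :
    Continuous fun x => piKappa ρ x C :=
  continuous_iff_lower_upperSemicontinuous.2
    ⟨lowerSemicontinuous_piKappa hρ C, upperSemicontinuous_piKappa hρ hC⟩

theorem notMem_of_piKappa_pos (hρ : ∀ i, IsQuasiKappaMetric (ρ i)) (hx : 0 < piKappa ρ x C) :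
    x ∉ C := by
  intro hxC
  obtain ⟨v, hv0, hv⟩ := exists_between hx
  obtain ⟨K, D, hcover, -, hD⟩ := IsCoverRadius.of_lt_piKappa hv
  obtain ⟨i, hi, hxi⟩ := mem_iUnion₂.1 (hcover.subset hxC)
  exact (hρ i).notMem_of_pos (hcover.isRegularlyClosed i hi) (hv0.trans_le (hD i hi)) hxi

theorem IsCylinderCover.piKappa_pos (h : IsCylinderCover K D C)
    (hpos : ∀ i ∈ K, 0 < ρ i (x i) (D i)) : 0 < piKappa ρ x C := by
  have hsmall : ∀ {r : ℝ≥0}, 0 < r → ∀ᶠ v in 𝓝[>] (0 : ℝ≥0), v ≤ r := fun hr =>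
    eventually_nhdsWithin_of_eventually_nhds (Iic_mem_nhds hr)
  have hcard : 0 < ((K.card : ℝ≥0) + 1)⁻¹ := by positivity
  obtain ⟨v, hv, hvK, hvD⟩ := (eventually_mem_nhdsWithin.and ((hsmall hcard).and
    ((eventually_all_finset K).2 fun i hi => hsmall (hpos i hi)))).exists
  exact hv.trans_le (IsCoverRadius.le_piKappa ⟨K, D, h, hvK, hvD⟩)

theorem IsRegularlyClosed.isCylinderCover_of_disjoint_pi (hC : IsRegularlyClosed C) {M : Finset ι}
    {O : ∀ i, Set (X i)} (h : Disjoint C ((M : Set ι).pi O)) :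
    IsCylinderCover M (fun i => (interior (closure (O i)))ᶜ) C where
  isRegularlyClosed _ _ := isRegularlyClosed_compl_interior_closure _
  subset x hx := by
    have hbox : (M : Set ι).pi (fun i => interior (closure (O i))) =
        interior (closure ((M : Set ι).pi O)) := by
      rw [closure_pi_set, interior_pi_set M.finite_toSet]
    have hxbox : x ∉ (M : Set ι).pi fun i => interior (closure (O i)) :=
      hbox ▸ disjoint_left.1 (hC.disjoint_interior_closure h) hx
    simpa [Set.mem_pi] using hxbox

theorem exists_piKappa_pos (hρ : ∀ i, IsQuasiKappaMetric (ρ i)) (hC : IsRegularlyClosed C)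
    (hG : IsOpen G) (hGC : Disjoint C G) (hne : G.Nonempty) : ∃ y ∈ G, 0 < piKappa ρ y C := by
  classical
  obtain ⟨x, hx⟩ := hne
  obtain ⟨M, O, hO, hMG⟩ := isOpen_pi_iff.1 hG x hx
  have hcover := hC.isCylinderCover_of_disjoint_pi (hGC.mono_right hMG)
  have hpos : ∀ i, ∃ y, i ∈ M → y ∈ O i ∧ 0 < ρ i y (interior (closure (O i)))ᶜ := by
    intro i
    by_cases hi : i ∈ M
    · obtain ⟨y, hy⟩ := (hρ i).exists_pos (hcover.isRegularlyClosed i hi) (hO i hi).1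
        ⟨x i, (hO i hi).2⟩ (by simpa only [compl_compl] using (hO i hi).1.subset_interior_closure)
      exact ⟨y, fun _ => hy⟩
    · exact ⟨x i, fun h => absurd h hi⟩
  choose y hy using hpos
  exact ⟨y, hMG fun i hi => (hy i hi).1, hcover.piKappa_pos fun i hi => (hy i hi).2⟩

theorem isQuasiKappaMetric_piKappa (hρ : ∀ i, IsQuasiKappaMetric (ρ i)) :
    IsQuasiKappaMetric (piKappa ρ) where
  exists_dense_open C hC := by
    refine ⟨{x | 0 < piKappa ρ x C}, isOpen_lt continuous_const (continuous_piKappa hρ hC),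
      fun x hx => notMem_of_piKappa_pos hρ hx, fun x hx => mem_closure_iff.2 fun G hG hxG => ?_,
      fun _ => Iff.rfl⟩
    obtain ⟨y, hy, hpos⟩ := exists_piKappa_pos hρ hC (hG.sdiff hC.isClosed) disjoint_sdiff_right
      ⟨x, hxG, hx⟩
    exact ⟨y, hy.1, hpos⟩
  anti C C' _ _ hCC' x := piKappa_anti hCC'
  continuous_left C hC := continuous_piKappa hρ hC
  closure_iUnion κ _ _ _ C hC hmono x := by
    let 𝒰 : Ultrafilter κ := .of atTop
    have hsub : closure (⋃ a, C a) ⊆ regularLiminf 𝒰 C :=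
      closure_minimal (iUnion_subset fun a => (hC a).subset_regularLiminf
        (Ultrafilter.of_le _ ((eventually_ge_atTop a).mono fun b hab => hmono hab)))
        isClosed_closure
    refine le_antisymm
      (le_ciInf fun a => piKappa_anti ((subset_iUnion C a).trans subset_closure)) ?_
    calc ⨅ a, piKappa ρ x (C a) ≤ piKappa ρ x (regularLiminf 𝒰 C) :=
          le_piKappa_regularLiminf hρ tendsto_const_nhds (.of_forall fun a => ciInf_le' _ a)
      _ ≤ piKappa ρ x (closure (⋃ a, C a)) := piKappa_anti hsub

theorem IsCoverRadius.tsub (hρ : ∀ i, IsRegularQuasiKappaMetric (ρ i))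
    (h : IsCoverRadius ρ x C v) (hr : r ≤ v) (hC' : ∀ y ∈ C', piKappa ρ y C < r) :
    IsCoverRadius ρ x C' (v - r) := by
  obtain ⟨K, D, hcover, hK, hD⟩ := h
  refine ⟨K, fun i => closure {z | ρ i z (D i) < r}, ⟨fun i hi => ?_, fun y hy => ?_⟩,
    tsub_le_self.trans hK, fun i hi => ?_⟩
  · exact isRegularlyClosed_closure_of_isOpen
      ((hρ i).isOpen_setOf_lt (hcover.isRegularlyClosed i hi) r)
  · by_contra hnot
    have hyr : ∀ i ∈ K, r ≤ ρ i (y i) (D i) := fun i hi => not_lt.1 fun hlt =>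
      hnot (mem_iUnion₂.2 ⟨i, hi, subset_closure hlt⟩)
    exact (hC' y hy).not_ge (IsCoverRadius.le_piKappa ⟨K, D, hcover, hr.trans hK, hyr⟩)
  · exact tsub_le_iff_right.2 ((hD i hi).trans
      ((hρ i).le_add_closure_setOf_lt (hcover.isRegularlyClosed i hi) (x i) r))

theorem piKappa_le_add (hρ : ∀ i, IsRegularQuasiKappaMetric (ρ i))
    (hr : ∀ y ∈ C', piKappa ρ y C ≤ r) : piKappa ρ x C ≤ piKappa ρ x C' + r := by
  refine le_of_forall_pos_le_add fun ε hε => ?_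
  rw [add_assoc]
  refine le_of_forall_lt_imp_le_of_dense fun v hv => ?_
  obtain hle | hlt := le_total v (r + ε)
  · exact hle.trans le_add_self
  · exact tsub_le_iff_right.1 ((IsCoverRadius.of_lt_piKappa hv).tsub hρ hlt fun y hy =>
      (hr y hy).trans_lt (lt_add_of_pos_right r hε)).le_piKappa

theorem isRegularQuasiKappaMetric_piKappa (hρ : ∀ i, IsRegularQuasiKappaMetric (ρ i)) :
    IsRegularQuasiKappaMetric (piKappa ρ) where
  toIsQuasiKappaMetric := isQuasiKappaMetric_piKappa fun i => (hρ i).toIsQuasiKappaMetric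
  le_add_iSup C C' _ _ x := by
    rcases eq_or_ne (⨆ y ∈ C', (piKappa ρ y C : ℝ≥0∞)) ⊤ with htop | htop
    · simp only [htop, add_top, le_top]
    · lift (⨆ y ∈ C', (piKappa ρ y C : ℝ≥0∞)) to ℝ≥0 using htop with s hs
      have hle : ∀ y ∈ C', (piKappa ρ y C : ℝ≥0∞) ≤ s := iSup₂_le_iff.1 hs.ge
      exact_mod_cast piKappa_le_add hρ fun y hy => ENNReal.coe_le_coe.1 (hle y hy)

end Product

theorem theorem2p5_general {ι : Type v} (X : ι → Type u) [∀ i, TopologicalSpace (X i)] :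
    ((∀ i, QuasiKappaMetrizable (X i)) → QuasiKappaMetrizable (∀ i, X i)) ∧
    ((∀ i, RegularlyQuasiKappaMetrizable (X i)) →
      RegularlyQuasiKappaMetrizable (∀ i, X i)) := by
  refine ⟨fun h => ?_, fun h => ?_⟩
  · choose ρ hρ using h
    exact ⟨piKappa ρ, isQuasiKappaMetric_piKappa hρ⟩
  · choose ρ hρ using h
    exact ⟨piKappa ρ, isRegularQuasiKappaMetric_piKappa hρ⟩

theorem theorem2p5 {ι : Type v} (X : ι → Type u) [∀ i, TopologicalSpace (X i)]
    [∀ i, T35Space (X i)] :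
    ((∀ i, QuasiKappaMetrizable (X i)) → QuasiKappaMetrizable (∀ i, X i)) ∧
    ((∀ i, RegularlyQuasiKappaMetrizable (X i)) →
      RegularlyQuasiKappaMetrizable (∀ i, X i)) :=
  theorem2p5_general X
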